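/- Let $m,n,q$ be positive integers with $q\ge n+1$, let $D\subset\mathbb C^m$ be a domain (a non-empty connected open set), and let $\mathcal A$ be an index set. For two points $[v],[w]\in P^n(\mathbb C)$ let $d([v],[w])=\arccos\frac{|\langle v,w\rangle|}{\|v\|\,\|w\|}$ be their Fubini–Study distance, and for $n+1$ points $a_0,\dots,a_n\in P^n(\mathbb C)$ let $$d_{FS}(a_0,\dots,a_n)=\min_{0\le i\le n}\ \inf\{d(a_i,y) : y \in \langle a_k : k\ne i\rangle\},$$ where $\langle a_k : k\neq i\rangle$ is the projective subspace of $P^n(\mathbb C)$ generated by the $n$ other points. Let $\{H_{1\alpha}\}_{\alpha\in\mathcal A},\dots,\{H_{q\alpha}\}_{\alpha\in\mathcal A}$ be $q$ families of holomorphic mappings of $D$ into $P^n(\mathbb C)$. Assume that for each compact subset $K$ of $D$ there is a constant $\delta_K>0$ such that $$d_{FS}\bigl(H_{j_0\alpha}(z),\dots,H_{j_n\alpha}(z)\bigr)\ge\delta_K$$ for all $z\in K$, all $\alpha\in\mathcal A$ and all $1\le j_0<j_1<\dots<j_n\le q$. Then each of the families $\{H_{1\alpha}\}_{\alpha\in\mathcal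 A},\dots,\{H_{q\alpha}\}_{\alpha\in\mathcal A}$ is normal on $D$; that is, for each $j$, every sequence in $\{H_{j\alpha}\}_{\alpha\in\mathcal A}$ has a subsequence that converges, uniformly on compact subsets of $D$ with respect to $d$, to a holomorphic mapping of $D$ into $P^n(\mathbb C)$. -/

import Mathlib

open scoped LinearAlgebra.Projectivization

/-- Complex Euclidean space `ℂ^m`. -/
abbrev CSpace (m : ℕ) : Type := EuclideanSpace ℂ (Fin m)

/-- Complex projective space `P^n(ℂ)`: the lines through the origin of `ℂ^(n+1)`. -/
abbrev CProj (n : ℕ) : Type := ℙ ℂ (CSpace (n + 1))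

/-- The Fubini–Study distance on `P^n(ℂ)`: for points `x = [v]` and `y = [w]` it is
`arccos (|⟨v, w⟩| / (‖v‖ ‖w‖))`, see `fsDist_mk` for the independence of representatives. -/
noncomputable def fsDist {n : ℕ} (x y : CProj n) : ℝ :=
  Real.arccos (‖inner ℂ x.rep y.rep‖ / (‖x.rep‖ * ‖y.rep‖))

theorem fsDist_mk {n : ℕ} (v w : CSpace (n + 1)) (hv : v ≠ 0) (hw : w ≠ 0) :
    fsDist (Projectivization.mk ℂ v hv) (Projectivization.mk ℂ w hw) =
      Real.arccos (‖inner ℂ v w‖ / (‖v‖ * ‖w‖)) := by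
  obtain ⟨a, ha⟩ := Projectivization.exists_smul_eq_mk_rep ℂ v hv
  obtain ⟨b, hb⟩ := Projectivization.exists_smul_eq_mk_rep ℂ w hw
  have ha0 : ‖(a : ℂ)‖ ≠ 0 := norm_ne_zero_iff.2 a.ne_zero
  have hb0 : ‖(b : ℂ)‖ ≠ 0 := norm_ne_zero_iff.2 b.ne_zero
  have hv0 : ‖v‖ ≠ 0 := norm_ne_zero_iff.2 hv
  have hw0 : ‖w‖ ≠ 0 := norm_ne_zero_iff.2 hw
  unfold fsDist
  rw [← ha, ← hb, Units.smul_def, Units.smul_def, inner_smul_left, inner_smul_right,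
    norm_mul, norm_mul, norm_smul, norm_smul, RCLike.norm_conj]
  congr 1
  field_simp

/-- The Fubini–Study distance from a point to a subset of `P^n(ℂ)`. It is meant for nonempty
subsets only. -/
noncomputable def fsInfDist {n : ℕ} (x : CProj n) (S : Set (CProj n)) : ℝ :=
  ⨅ y : S, fsDist x y

/-- `d_FS(a_0, …, a_n)`: the minimum over `i` of the Fubini–Study distances from the point `a_i`
to the projective subspace generated by the `n` other points `a_k`, `k ≠ i`. It is meant for
`1 ≤ n`, so that these subspaces are nonempty. -/
noncomputable def dFS {n : ℕ} (a : Fin (n + 1) → CProj n) : ℝ :=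
  ⨅ i : Fin (n + 1),
    fsInfDist (a i) (Projectivization.Subspace.span (a '' {k | k ≠ i}) : Set (CProj n))

/-- `f` is a holomorphic mapping of the open set `D ⊆ ℂ^m` into `P^n(ℂ)`: around each point of `D`
it has a reduced representation `f = [F] = (F_0 : ⋯ : F_n)`, where the `F_i` are holomorphic and
have no common zeros. (Values of `f` outside `D` play no role.) -/
def IsHolomorphicMap {m n : ℕ} (D : Set (CSpace m)) (f : CSpace m → CProj n) : Prop :=
  ∀ z ∈ D, ∃ U : Set (CSpace m), IsOpen U ∧ z ∈ U ∧ U ⊆ D ∧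
    ∃ F : CSpace m → CSpace (n + 1), DifferentiableOn ℂ F U ∧
      ∀ w ∈ U, ∃ hw : F w ≠ 0, f w = Projectivization.mk ℂ (F w) hw

/-- The sequence `f` converges to `g` uniformly on compact subsets of `D`, with respect to the
Fubini–Study distance. -/
def ConvergesCompactly {m n : ℕ} (D : Set (CSpace m)) (f : ℕ → CSpace m → CProj n)
    (g : CSpace m → CProj n) : Prop :=
  ∀ K ⊆ D, IsCompact K → ∀ ε > 0, ∃ N : ℕ, ∀ k ≥ N, ∀ z ∈ K, fsDist (f k z) (g z) < ε

/-- A family of mappings of `D` into `P^n(ℂ)` is normal on `D` if every sequence in it has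
a subsequence that converges uniformly on compact subsets of `D` to a holomorphic mapping of `D`
into `P^n(ℂ)`. -/
def IsNormalFamily {m n : ℕ} (D : Set (CSpace m)) (ℱ : Set (CSpace m → CProj n)) : Prop :=
  ∀ f : ℕ → CSpace m → CProj n, (∀ k, f k ∈ ℱ) →
    ∃ φ : ℕ → ℕ, StrictMono φ ∧ ∃ g : CSpace m → CProj n,
      IsHolomorphicMap D g ∧ ConvergesCompactly D (fun k => f (φ k)) g

/-! The separation hypothesis turns maps into projective space into uniformly bounded
operator-valued holomorphic functions. Given `j`, choose `n + 1` of the `q` indices including `j`.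
At each `z` the corresponding lines span `ℂ^(n+1)`; let `P z` be the projection onto the `j`-th line
along the span of the others. It does not depend on representatives, hence is holomorphic in `z`,
and a separation angle `δ` forces `‖P z‖ ≤ 1 / sin δ` (`norm_lineProj_le`). Montel's theorem then
gives a subsequence of the `P`'s converging compactly to a holomorphic `Q`. Rank at most one is a
closed condition, so it passes to `Q z`. Each `P` fixes the vectors of its own line, so for large
indices `Q z` nearly fixes them: thus `Q z ≠ 0`, and its image is a line close to the given one. The
limit map sends `z` to the image of `Q z`. -/

open Filter Topology Metric

/-! ### Weierstrass and Montel theorems for vector-valued maps. -/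

section Montel

variable {E F : Type*} [NormedAddCommGroup E] [NormedSpace ℂ E]
  [NormedAddCommGroup F] [NormedSpace ℂ F]

/-- **Weierstrass' theorem** in several complex variables. -/
theorem differentiableOn_of_tendstoUniformlyOn_isCompact [ProperSpace E] [CompleteSpace F]
    {D : Set E} (hD : IsOpen D) {f : ℕ → E → F} {g : E → F}
    (hf : ∀ k, DifferentiableOn ℂ (f k) D)
    (hlim : ∀ K ⊆ D, IsCompact K → TendstoUniformlyOn f g atTop K) :
    DifferentiableOn ℂ g D := by
  intro x hx
  obtain ⟨r, hr, hrD⟩ := nhds_basis_closedBall.mem_iff.1 (hD.mem_nhds hx)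
  have hunif := (hlim _ hrD (isCompact_closedBall x r)).uniformCauchySeqOn
  have hdiff : ∀ k, ∀ y ∈ closedBall x r, DifferentiableAt ℂ (f k) y := fun k y hy =>
    (hf k y (hrD hy)).differentiableAt (hD.mem_nhds (hrD hy))
  have hsub : ∀ y ∈ ball x (r / 2), ball y (r / 2) ⊆ closedBall x r := fun y hy =>
    (ball_subset_ball' (by linarith [mem_ball.1 hy])).trans ball_subset_closedBall
  have hmem : ∀ y ∈ ball x (r / 2), y ∈ closedBall x r := fun y hy =>
    hsub y hy (mem_ball_self (by positivity))
  have hcauchy : UniformCauchySeqOn (fun k y => fderiv ℂ (f k) y) atTop (ball x (r / 2)) := by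
    rw [Metric.uniformCauchySeqOn_iff] at hunif ⊢
    intro ε hε
    -- The difference oscillates by at most `ε * r / 4` on a ball of radius `r / 2`, so Cauchy's
    -- estimate bounds its derivative by `ε / 2`.
    obtain ⟨N, hN⟩ := hunif (ε * r / 8) (by positivity)
    refine ⟨N, fun k hk l hl y hy => ?_⟩
    have hkl : ∀ w ∈ closedBall x r, ‖f k w - f l w‖ < ε * r / 8 := fun w hw => by
      simpa [dist_eq_norm] using hN k hk l hl w hw
    have hd : DifferentiableOn ℂ (f k - f l) (ball y (r / 2)) := fun w hw =>
      ((hdiff k w (hsub y hy hw)).sub (hdiff l w (hsub y hy hw))).differentiableWithinAt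
    have hm : Set.MapsTo (f k - f l) (ball y (r / 2))
        (closedBall ((f k - f l) y) (ε * r / 4)) := fun w hw => by
      rw [mem_closedBall, dist_eq_norm]
      refine (norm_sub_le _ _).trans ?_
      have h1 := hkl w (hsub y hy hw)
      have h2 := hkl y (hmem y hy)
      simp only [Pi.sub_apply]
      linarith
    have := Complex.norm_fderiv_le_div_of_mapsTo_ball hd hm (by positivity)
    rw [fderiv_sub (hdiff k y (hmem y hy)) (hdiff l y (hmem y hy))] at this
    rw [dist_eq_norm]
    refine this.trans_lt ?_
    rw [div_lt_iff₀ (by positivity)]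
    nlinarith
  have hex : ∀ y, ∃ L, y ∈ ball x (r / 2) → Tendsto (fun k => fderiv ℂ (f k) y) atTop (𝓝 L) := by
    intro y
    by_cases hy : y ∈ ball x (r / 2)
    · obtain ⟨L, hL⟩ := cauchySeq_tendsto_of_complete (hcauchy.cauchySeq hy)
      exact ⟨L, fun _ => hL⟩
    · exact ⟨0, fun h => absurd h hy⟩
  choose g' hg' using hex
  have hderiv : HasFDerivAt g (g' x) x :=
    hasFDerivAt_of_tendstoUniformlyOn isOpen_ball (hcauchy.tendstoUniformlyOn_of_tendsto hg')
      (fun k y hy => (hdiff k y (hmem y hy)).hasFDerivAt)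
      (fun y hy => (hlim _ hrD (isCompact_closedBall x r)).tendsto_at (hmem y hy))
      (mem_ball_self (by positivity))
  exact hderiv.differentiableAt.differentiableWithinAt

/-- **Montel's theorem** in several complex variables. -/
theorem exists_subseq_tendstoUniformlyOn_of_norm_le [ProperSpace E] [ProperSpace F]
    {D : Set E} (hD : IsOpen D) {f : ℕ → E → F} (hf : ∀ k, DifferentiableOn ℂ (f k) D)
    (hbd : ∀ K ⊆ D, IsCompact K → ∃ M : ℝ, ∀ k, ∀ z ∈ K, ‖f k z‖ ≤ M) :
    ∃ φ : ℕ → ℕ, StrictMono φ ∧ ∃ g : E → F, DifferentiableOn ℂ g D ∧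
      ∀ K ⊆ D, IsCompact K → TendstoUniformlyOn (fun k => f (φ k)) g atTop K := by
  classical
  have : LocallyCompactSpace D := hD.locallyCompactSpace
  have : SigmaCompactSpace D := sigmaCompactSpace_of_locallyCompact_secondCountable
  let G : ℕ → C(D, F) := fun k => ⟨D.domRestrict (f k), (hf k).continuousOn.domRestrict⟩
  have hequi : Equicontinuous ((fun h : C(D, F) => (h : D → F)) ∘
      ((↑) : Set.range G → C(D, F))) := by
    intro x
    rw [Metric.equicontinuousAt_iff]
    obtain ⟨r, hr, hrD⟩ := nhds_basis_closedBall.mem_iff.1 (hD.mem_nhds x.2)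
    obtain ⟨M, hM⟩ := hbd _ hrD (isCompact_closedBall _ r)
    intro ε hε
    have hM0 : 0 ≤ M := (norm_nonneg _).trans (hM 0 x (mem_closedBall_self hr.le))
    -- By the Schwarz lemma every `f k` has slope at most `2 * M / r` from `x`; the `+ 1` covers `M
    -- = 0`.
    refine ⟨min r (ε * r / (2 * M + 1)), by positivity, ?_⟩
    rintro y hy ⟨_, k, rfl⟩
    have hyr : (y : E) ∈ ball (x : E) r := hy.trans_le (min_le_left _ _)
    have hy2 : dist (y : E) x < ε * r / (2 * M + 1) := hy.trans_le (min_le_right _ _)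
    have hm : Set.MapsTo (f k) (ball (x : E) r) (closedBall (f k x) (2 * M)) := fun w hw => by
      rw [mem_closedBall, dist_eq_norm]
      refine (norm_sub_le _ _).trans ?_
      linarith [hM k w (ball_subset_closedBall hw), hM k x (mem_closedBall_self hr.le)]
    have := Complex.dist_le_div_mul_dist_of_mapsTo_ball
      ((hf k).mono (ball_subset_closedBall.trans hrD)) hm hyr
    rw [dist_comm]
    refine this.trans_lt ?_
    rw [lt_div_iff₀ (by positivity)] at hy2
    rw [div_mul_eq_mul_div, div_lt_iff₀ hr]
    nlinarith [dist_nonneg (x := (y : E)) (y := x)]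
  have : T2Space (UniformOnFun D F {K : Set D | IsCompact K}) :=
    UniformOnFun.t2Space_of_covering
      (Set.eq_univ_of_forall fun x =>
        Set.mem_sUnion_of_mem (Set.mem_singleton x) isCompact_singleton)
  have hemb : IsClosedEmbedding (UniformOnFun.ofFun {K : Set D | IsCompact K} ∘
      (fun h : C(D, F) => (h : D → F))) :=
    ⟨ContinuousMap.isUniformEmbedding_toUniformOnFunIsCompact.isEmbedding,
      ContinuousMap.isUniformEmbedding_toUniformOnFunIsCompact.isUniformInducing.isComplete_range
        |>.isClosed⟩
  have hcpt : IsCompact (closure (Set.range G)) := by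
    refine ArzelaAscoli.isCompact_closure_of_isClosedEmbedding (fun K hK => hK) hemb
      (fun K _ => hequi.equicontinuousOn K) ?_
    intro K _ x _
    obtain ⟨M, hM⟩ := hbd {(x : E)} (by simp) isCompact_singleton
    refine ⟨closedBall 0 M, isCompact_closedBall _ _, ?_⟩
    rintro _ ⟨k, rfl⟩
    simpa [G] using hM k x rfl
  obtain ⟨h, -, φ, hφ, hlim⟩ := hcpt.tendsto_subseq fun k => subset_closure (Set.mem_range_self k)
  let g : E → F := fun z => if hz : z ∈ D then h ⟨z, hz⟩ else 0
  have hconv : ∀ K ⊆ D, IsCompact K → TendstoUniformlyOn (fun k => f (φ k)) g atTop K := by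
    intro K hKD hK
    have hK' : IsCompact (((↑) : D → E) ⁻¹' K) :=
      Topology.IsInducing.subtypeVal.isCompact_preimage' hK (by simpa using hKD)
    have := ContinuousMap.tendsto_iff_forall_isCompact_tendstoUniformlyOn.1 hlim _ hK'
    rw [Metric.tendstoUniformlyOn_iff] at this ⊢
    intro ε hε
    filter_upwards [this ε hε] with k hk z hz
    have := hk ⟨z, hKD hz⟩ hz
    simp only [g, hKD hz, dite_true]
    exact this
  exact ⟨φ, hφ, g, differentiableOn_of_tendstoUniformlyOn_isCompact hD (fun k => hf (φ k)) hconv,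
    hconv⟩

end Montel

/-! ### Projections onto one line of a basis. -/

section LineProjection

/-- The endomorphism of `ℂ^(n+1)` with columns `h_0, …, h_n`. -/
noncomputable def columnMap {n : ℕ} (h : Fin (n + 1) → CSpace (n + 1)) :
    CSpace (n + 1) →L[ℂ] CSpace (n + 1) :=
  ∑ k, (EuclideanSpace.proj k : CSpace (n + 1) →L[ℂ] ℂ).smulRight (h k)

/-- If `h_0, …, h_n` is a basis of `ℂ^(n+1)`, the projection onto the line `ℂ h_i` along the span of
the other vectors. -/
noncomputable def lineProj {n : ℕ} (i : Fin (n + 1)) (h : Fin (n + 1) → CSpace (n + 1)) :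
    CSpace (n + 1) →L[ℂ] CSpace (n + 1) :=
  columnMap h * (EuclideanSpace.proj i : CSpace (n + 1) →L[ℂ] ℂ).smulRight
    (EuclideanSpace.single i 1) * Ring.inverse (columnMap h)

variable {n : ℕ} {h h' : Fin (n + 1) → CSpace (n + 1)}

theorem columnMap_single (h : Fin (n + 1) → CSpace (n + 1)) (k : Fin (n + 1)) :
    columnMap h (EuclideanSpace.single k 1) = h k := by
  simp [columnMap, ite_smul]

theorem isUnit_columnMap (hh : LinearIndependent ℂ h) : IsUnit (columnMap h) := by
  have hcard : Fintype.card (Fin (n + 1)) = Module.finrank ℂ (CSpace (n + 1)) := by simp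
  let b := basisOfLinearIndependentOfCardEqFinrank hh hcard
  let e := ((EuclideanSpace.basisFun (Fin (n + 1)) ℂ).toBasis.equiv b
    (Equiv.refl _)).toContinuousLinearEquiv
  have he : columnMap h = (e : CSpace (n + 1) →L[ℂ] CSpace (n + 1)) := by
    refine ContinuousLinearMap.coe_injective
      ((EuclideanSpace.basisFun (Fin (n + 1)) ℂ).toBasis.ext fun k => ?_)
    have : e ((EuclideanSpace.basisFun (Fin (n + 1)) ℂ).toBasis k) = b k :=
      Module.Basis.equiv_apply ..
    change columnMap h _ = e _
    rw [this]
    simp [b, columnMap_single]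
  rw [he]
  exact (ContinuousLinearEquiv.toUnit e).isUnit

theorem lineProj_apply (hh : LinearIndependent ℂ h) (i k : Fin (n + 1)) :
    lineProj i h (h k) = if k = i then h k else 0 := by
  have hinv : Ring.inverse (columnMap h) (h k) = EuclideanSpace.single k 1 := by
    conv_lhs => rw [← columnMap_single h k]
    rw [← mul_apply_eq_comp, Ring.inverse_mul_cancel _ (isUnit_columnMap hh),
      one_apply_eq_self]
  rw [lineProj, mul_apply_eq_comp, hinv, mul_apply_eq_comp]
  by_cases hk : k = i
  · subst hk; simp [columnMap_single]
  · simp [hk, Ne.symm hk]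

theorem span_range_eq_top_of_linearIndependent (hh : LinearIndependent ℂ h) :
    Submodule.span ℂ (Set.range h) = ⊤ :=
  hh.span_eq_top_of_card_eq_finrank' (by simp)

/-- Only the lines `ℂ h_k` matter, so the projection is a function of points of projective space. -/
theorem lineProj_smul (hh : LinearIndependent ℂ h) (i : Fin (n + 1)) {c : Fin (n + 1) → ℂ}
    (hc : ∀ k, c k ≠ 0) : lineProj i (fun k => c k • h k) = lineProj i h := by
  have hh' : LinearIndependent ℂ (fun k => c k • h k) :=
    hh.units_smul fun k => Units.mk0 (c k) (hc k)
  refine ContinuousLinearMap.coe_injective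
    (LinearMap.ext_on (span_range_eq_top_of_linearIndependent hh') ?_)
  rintro _ ⟨k, rfl⟩
  change lineProj i (fun k => c k • h k) (c k • h k) = lineProj i h (c k • h k)
  rw [lineProj_apply hh' i k, map_smul, lineProj_apply hh]
  split_ifs <;> simp

/-- Every vector splits along `ℂ h_i` and the span of the other vectors. -/
theorem exists_eq_smul_add (hh : LinearIndependent ℂ h) (i : Fin (n + 1)) (x : CSpace (n + 1)) :
    ∃ c : ℂ, lineProj i h x = c • h i ∧ x - c • h i ∈ Submodule.span ℂ (h '' {k | k ≠ i}) := by
  have hx : x ∈ Submodule.span ℂ (Set.range h) := by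
    rw [span_range_eq_top_of_linearIndependent hh]; trivial
  induction hx using Submodule.span_induction with
  | mem x hx =>
    obtain ⟨k, rfl⟩ := hx
    rw [lineProj_apply hh]
    by_cases hk : k = i
    · subst hk; exact ⟨1, by simp⟩
    · exact ⟨0, by simp [hk], by
        simpa using Submodule.subset_span (Set.mem_image_of_mem h (show k ∈ {k | k ≠ i} from hk))⟩
  | zero => exact ⟨0, by simp⟩
  | add x y _ _ hx hy =>
    obtain ⟨c, hc, hc'⟩ := hx
    obtain ⟨d, hd, hd'⟩ := hy
    refine ⟨c + d, by rw [map_add, hc, hd, add_smul], ?_⟩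
    convert add_mem hc' hd' using 1
    module
  | smul a x _ hx =>
    obtain ⟨c, hc, hc'⟩ := hx
    refine ⟨a * c, by rw [map_smul, hc, mul_smul], ?_⟩
    convert Submodule.smul_mem _ a hc' using 1
    module

/-- The projection is `A E A⁻¹` with `E` constant and `A` linear in the columns, and inversion is
holomorphic at units. -/
theorem differentiableOn_lineProj {m : ℕ} {U : Set (CSpace m)}
    {F : Fin (n + 1) → CSpace m → CSpace (n + 1)} (hF : ∀ k, DifferentiableOn ℂ (F k) U)
    (hind : ∀ z ∈ U, LinearIndependent ℂ (fun k => F k z)) (i : Fin (n + 1)) :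
    DifferentiableOn ℂ (fun z => lineProj i (fun k => F k z)) U := by
  have hA : DifferentiableOn ℂ (fun z => columnMap (fun k => F k z)) U := by
    unfold columnMap
    refine DifferentiableOn.fun_sum fun k _ => ?_
    exact (ContinuousLinearMap.smulRightL ℂ (CSpace (n + 1)) (CSpace (n + 1))
      (EuclideanSpace.proj k)).differentiable.comp_differentiableOn (hF k)
  have hinv : DifferentiableOn ℂ (fun z => Ring.inverse (columnMap (fun k => F k z))) U :=
    fun z hz => DifferentiableAt.comp_differentiableWithinAt (g := Ring.inverse) z
      (differentiableAt_inverse (isUnit_columnMap (hind z hz))) (hA z hz)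
  exact (hA.mul_const _).mul hinv

end LineProjection

/-! ### Separation angle and the norm of the projections. -/

section Separation

variable {n : ℕ}

theorem norm_inner_le_of_le_fsDist {v w : CSpace (n + 1)} (hv : v ≠ 0) (hw : w ≠ 0) {δ : ℝ}
    (hδ : 0 ≤ δ) (h : δ ≤ fsDist (Projectivization.mk ℂ v hv) (Projectivization.mk ℂ w hw)) :
    ‖inner ℂ v w‖ ≤ Real.cos δ * (‖v‖ * ‖w‖) := by
  have hpos : 0 < ‖v‖ * ‖w‖ := mul_pos (norm_pos_iff.2 hv) (norm_pos_iff.2 hw)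
  rw [fsDist_mk] at h
  have h1 : ‖inner ℂ v w‖ / (‖v‖ * ‖w‖) ≤ 1 := (div_le_one hpos).2 (norm_inner_le_norm v w)
  have h0 : 0 ≤ ‖inner ℂ v w‖ / (‖v‖ * ‖w‖) := by positivity
  have := Real.cos_le_cos_of_nonneg_of_le_pi hδ (Real.arccos_le_pi _) h
  rw [Real.cos_arccos (by linarith) h1, div_le_iff₀ hpos] at this
  exact this

theorem fsDist_nonneg (x y : CProj n) : 0 ≤ fsDist x y := Real.arccos_nonneg _

theorem dFS_le_fsDist (a : Fin (n + 1) → CProj n) (i : Fin (n + 1)) {y : CProj n}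
    (hy : y ∈ Projectivization.Subspace.span (a '' {k | k ≠ i})) : dFS a ≤ fsDist (a i) y := by
  have hbdd : BddBelow (Set.range fun y : (Projectivization.Subspace.span (a '' {k | k ≠ i}) :
      Set (CProj n)) => fsDist (a i) y) := ⟨0, by rintro _ ⟨y, rfl⟩; exact fsDist_nonneg _ _⟩
  exact (ciInf_le (Set.finite_range _).bddBelow i).trans (ciInf_le hbdd ⟨y, hy⟩)

theorem mk_mem_span {ι : Type*} {h : ι → CSpace (n + 1)} (hh : ∀ k, h k ≠ 0) {s : Set ι}
    {w : CSpace (n + 1)} (hw : w ≠ 0) (hws : w ∈ Submodule.span ℂ (h '' s)) :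
    Projectivization.mk ℂ w hw ∈
      Projectivization.Subspace.span ((fun k => Projectivization.mk ℂ (h k) (hh k)) '' s) := by
  rw [← Projectivization.Subspace.mem_submodule_iff]
  refine Submodule.span_le.2 ?_ hws
  rintro _ ⟨k, hk, rfl⟩
  refine (Projectivization.Subspace.mem_submodule_iff _ (hh k)).2 ?_
  exact Projectivization.Subspace.subset_span _ ⟨k, hk, rfl⟩

/-- Separation of lines in terms of representatives. -/
theorem norm_inner_le_of_le_dFS {h : Fin (n + 1) → CSpace (n + 1)} (hh : ∀ k, h k ≠ 0) {δ : ℝ}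
    (hδ : 0 ≤ δ) (hsep : δ ≤ dFS fun k => Projectivization.mk ℂ (h k) (hh k)) (i : Fin (n + 1))
    {w : CSpace (n + 1)} (hws : w ∈ Submodule.span ℂ (h '' {k | k ≠ i})) :
    ‖inner ℂ (h i) w‖ ≤ Real.cos δ * (‖h i‖ * ‖w‖) := by
  by_cases hw : w = 0
  · simp [hw]
  · exact norm_inner_le_of_le_fsDist (hh i) hw hδ
      (hsep.trans (dFS_le_fsDist _ i (mk_mem_span hh hw hws)))

/-- If `h i` lay in the span of the others, it would make an angle at least `δ > 0` with itself. -/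
theorem linearIndependent_of_le_dFS {h : Fin (n + 1) → CSpace (n + 1)} (hh : ∀ k, h k ≠ 0) {δ : ℝ}
    (hδ : 0 < δ) (hδ' : δ < Real.pi)
    (hsep : δ ≤ dFS fun k => Projectivization.mk ℂ (h k) (hh k)) : LinearIndependent ℂ h := by
  rw [linearIndependent_iff_notMem_span]
  intro i hi
  have hset : h '' (Set.univ \ {i}) = h '' {k | k ≠ i} := by
    congr 1; ext; simp
  rw [hset] at hi
  have := norm_inner_le_of_le_dFS hh hδ.le hsep i hi
  rw [inner_self_eq_norm_sq_to_K, norm_pow, RCLike.norm_ofReal, abs_norm] at this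
  have hpos : 0 < ‖h i‖ := norm_pos_iff.2 (hh i)
  have hs : 0 < Real.sin δ := Real.sin_pos_of_pos_of_lt_pi hδ hδ'
  have hc : Real.cos δ < 1 := by nlinarith [Real.sin_sq_add_cos_sq δ]
  nlinarith [mul_pos hpos hpos]

/-- Complete the square: `‖v‖² - 2c‖v‖‖w‖ + ‖w‖² = (1 - c²)‖v‖² + (c‖v‖ - ‖w‖)²`. -/
theorem mul_norm_le_norm_add {v w : CSpace (n + 1)} {c : ℝ}
    (hvw : ‖inner ℂ v w‖ ≤ c * (‖v‖ * ‖w‖)) : (1 - c ^ 2) * ‖v‖ ^ 2 ≤ ‖v + w‖ ^ 2 := by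
  rw [norm_add_sq (𝕜 := ℂ)]
  have : -‖inner ℂ v w‖ ≤ RCLike.re (inner ℂ v w) :=
    (abs_le.1 (RCLike.abs_re_le_norm (inner ℂ v w))).1
  nlinarith [sq_nonneg (c * ‖v‖ - ‖w‖)]

/-- The component of `x` along `h i` and the remainder meet at an angle at least `δ`, so `‖x‖` is at
least `sin δ` times the norm of that component. -/
theorem norm_lineProj_le {h : Fin (n + 1) → CSpace (n + 1)} (hh : ∀ k, h k ≠ 0) {δ : ℝ}
    (hδ : 0 < δ) (hδ' : δ < Real.pi)
    (hsep : δ ≤ dFS fun k => Projectivization.mk ℂ (h k) (hh k)) (i : Fin (n + 1)) :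
    ‖lineProj i h‖ ≤ 1 / Real.sin δ := by
  have hs : 0 < Real.sin δ := Real.sin_pos_of_pos_of_lt_pi hδ hδ'
  refine ContinuousLinearMap.opNorm_le_bound _ (by positivity) fun x => ?_
  obtain ⟨c, hc, hc'⟩ := exists_eq_smul_add (linearIndependent_of_le_dFS hh hδ hδ' hsep) i x
  have hin : ‖inner ℂ (c • h i) (x - c • h i)‖ ≤
      Real.cos δ * (‖c • h i‖ * ‖x - c • h i‖) := by
    have := norm_inner_le_of_le_dFS hh hδ.le hsep i hc'
    rw [inner_smul_left, norm_mul, RCLike.norm_conj, norm_smul]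
    nlinarith [mul_le_mul_of_nonneg_left this (norm_nonneg c)]
  have := mul_norm_le_norm_add hin
  rw [add_sub_cancel, ← Real.sin_sq, ← mul_pow, ← hc] at this
  rw [div_mul_eq_mul_div, one_mul, le_div_iff₀ hs, mul_comm]
  exact (sq_le_sq₀ (by positivity) (norm_nonneg x)).1 this

end Separation

/-! ### Projections attached to tuples of projective points. -/

section ProjectiveTuples

variable {m n : ℕ}

/-- For points `a_0, …, a_n` of `P^n(ℂ)` in general position, the projection of `ℂ^(n+1)` onto the
line `a_i` along the span of the other lines. -/
noncomputable def projOntoPoint (i : Fin (n + 1)) (a : Fin (n + 1) → CProj n) :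
    CSpace (n + 1) →L[ℂ] CSpace (n + 1) :=
  lineProj i fun k => (a k).rep

theorem projOntoPoint_mk {h : Fin (n + 1) → CSpace (n + 1)} (hh : LinearIndependent ℂ h)
    (i : Fin (n + 1)) :
    projOntoPoint i (fun k => Projectivization.mk ℂ (h k) (hh.ne_zero k)) = lineProj i h := by
  choose c hc using fun k => Projectivization.exists_smul_eq_mk_rep ℂ (h k) (hh.ne_zero k)
  unfold projOntoPoint
  rw [← lineProj_smul hh i fun k => (c k).ne_zero]
  congr 1
  funext k
  rw [← hc k, Units.smul_def]

theorem linearIndependent_rep_of_le_dFS {a : Fin (n + 1) → CProj n} {δ : ℝ} (hδ : 0 < δ)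
    (hδ' : δ < Real.pi) (ha : δ ≤ dFS a) : LinearIndependent ℂ fun k => (a k).rep :=
  linearIndependent_of_le_dFS (fun k => (a k).rep_nonzero) hδ hδ' (by simpa using ha)

theorem norm_projOntoPoint_le {a : Fin (n + 1) → CProj n} {δ : ℝ} (hδ : 0 < δ)
    (hδ' : δ < Real.pi) (ha : δ ≤ dFS a) (i : Fin (n + 1)) :
    ‖projOntoPoint i a‖ ≤ 1 / Real.sin δ :=
  norm_lineProj_le (fun k => (a k).rep_nonzero) hδ hδ' (by simpa using ha) i

theorem projOntoPoint_rep {a : Fin (n + 1) → CProj n}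
    (ha : LinearIndependent ℂ fun k => (a k).rep) (i : Fin (n + 1)) :
    projOntoPoint i a (a i).rep = (a i).rep := by
  simpa [projOntoPoint] using lineProj_apply ha i i

/-- Rank at most one, written as polynomial identities in the entries so that it survives pointwise
limits. -/
theorem projOntoPoint_collinear {a : Fin (n + 1) → CProj n}
    (ha : LinearIndependent ℂ fun k => (a k).rep) (i : Fin (n + 1)) (x y : CSpace (n + 1))
    (b : Fin (n + 1)) :
    projOntoPoint i a x b • projOntoPoint i a y = projOntoPoint i a y b • projOntoPoint i a x := by
  obtain ⟨c, hc, -⟩ := exists_eq_smul_add ha i x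
  obtain ⟨d, hd, -⟩ := exists_eq_smul_add ha i y
  unfold projOntoPoint
  rw [hc, hd, smul_smul, smul_smul]
  congr 1
  simp only [PiLp.smul_apply, smul_eq_mul]
  ring

/-- The chosen `rep` need not vary continuously with `z`; locally it is replaced by reduced
representations, which give the same projection. -/
theorem differentiableOn_projOntoPoint {D : Set (CSpace m)}
    {f : Fin (n + 1) → CSpace m → CProj n} (hf : ∀ k, IsHolomorphicMap D (f k))
    (hind : ∀ z ∈ D, LinearIndependent ℂ fun k => (f k z).rep) (i : Fin (n + 1)) :
    DifferentiableOn ℂ (fun z => projOntoPoint i fun k => f k z) D := by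
  intro z hz
  choose U hUo hzU hUD F hF hFf using fun k => hf k z hz
  have hVo : IsOpen (⋂ k, U k) := isOpen_iInter_of_finite hUo
  have hzV : z ∈ ⋂ k, U k := Set.mem_iInter.2 hzU
  have hFind : ∀ w ∈ ⋂ k, U k, LinearIndependent ℂ fun k => F k w := by
    intro w hw
    have hwU := Set.mem_iInter.1 hw
    have := hind w (hUD 0 (hwU 0))
    choose hne heq using fun k => hFf k w (hwU k)
    choose c hc using fun k => Projectivization.exists_smul_eq_mk_rep ℂ (F k w) (hne k)
    convert this.units_smul fun k => (c k)⁻¹ using 1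
    funext k
    simp only [Pi.smul_apply', heq, ← hc, inv_smul_smul]
  have heq : Set.EqOn (fun w => projOntoPoint i fun k => f k w)
      (fun w => lineProj i fun k => F k w) (⋂ k, U k) := by
    intro w hw
    have hwU := Set.mem_iInter.1 hw
    choose hne heq using fun k => hFf k w (hwU k)
    simp only [heq]
    exact projOntoPoint_mk (hFind w hw) i
  have hdiff := differentiableOn_lineProj (fun k => (hF k).mono (Set.iInter_subset U k)) hFind i
  exact ((hdiff.congr heq).differentiableAt (hVo.mem_nhds hzV)).differentiableWithinAt

end ProjectiveTuples

/-! ### From operators back to points. -/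

section Limits

variable {m n : ℕ}

/-- Here `|⟨v, w⟩| ≥ (1 - η)‖v‖²` and `‖w‖ ≤ (1 + η)‖v‖`. -/
theorem fsDist_mk_le_arccos {v w : CSpace (n + 1)} (hv : v ≠ 0) (hw : w ≠ 0) {η : ℝ}
    (hη : 0 ≤ η) (h : ‖v - w‖ ≤ η * ‖v‖) :
    fsDist (Projectivization.mk ℂ v hv) (Projectivization.mk ℂ w hw) ≤
      Real.arccos ((1 - η) / (1 + η)) := by
  have hv0 : 0 < ‖v‖ := norm_pos_iff.2 hv
  have hw0 : 0 < ‖w‖ := norm_pos_iff.2 hw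
  rw [fsDist_mk]
  refine Real.arccos_le_arccos ?_
  rw [div_le_div_iff₀ (by positivity) (by positivity)]
  have hwle : ‖w‖ ≤ (1 + η) * ‖v‖ := by
    have := norm_sub_norm_le w v
    rw [norm_sub_rev] at this
    linarith
  have hin : (1 - η) * ‖v‖ ^ 2 ≤ ‖inner ℂ v w‖ := by
    have h1 : inner ℂ v w = inner ℂ v v - inner ℂ v (v - w) := by rw [inner_sub_right]; ring
    have h2 : ‖inner ℂ v v‖ = ‖v‖ ^ 2 := by
      rw [inner_self_eq_norm_sq_to_K, norm_pow, RCLike.norm_ofReal, abs_norm]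
    have h3 := norm_inner_le_norm (𝕜 := ℂ) v (v - w)
    have h4 := norm_sub_norm_le (inner ℂ v v) (inner ℂ v (v - w))
    rw [h1]
    nlinarith
  rcases le_total 0 (1 - η) with h1 | h1
  · nlinarith [mul_le_mul_of_nonneg_left hwle (mul_nonneg h1 hv0.le)]
  · have : 0 ≤ ‖inner ℂ v w‖ * (1 + η) := by positivity
    nlinarith [mul_nonneg (sub_nonneg.2 h1) (mul_pos hv0 hw0).le]

theorem exists_pos_arccos_lt {ε : ℝ} (hε : 0 < ε) :
    ∃ η : ℝ, 0 < η ∧ η < 1 ∧ Real.arccos ((1 - η) / (1 + η)) < ε := by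
  have hcont : ContinuousAt (fun η : ℝ => Real.arccos ((1 - η) / (1 + η))) 0 := by
    refine Real.continuous_arccos.continuousAt.comp ?_
    exact ContinuousAt.div (by fun_prop) (by fun_prop) (by norm_num)
  have hev : ∀ᶠ η : ℝ in 𝓝[>] 0, Real.arccos ((1 - η) / (1 + η)) < ε :=
    (hcont.eventually_lt continuousAt_const (by simpa using hε)).filter_mono nhdsWithin_le_nhds
  have hIoo : ∀ᶠ η : ℝ in 𝓝[>] 0, η ∈ Set.Ioo (0 : ℝ) 1 := Ioo_mem_nhdsGT one_pos
  obtain ⟨η, ⟨h0, h1⟩, h2⟩ := (hIoo.and hev).exists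
  exact ⟨η, h0, h1, h2⟩

open Classical in
/-- The point of `P^n(ℂ)` given by the image of an operator of rank one. -/
noncomputable def imagePoint (Q : CSpace (n + 1) →L[ℂ] CSpace (n + 1)) : CProj n :=
  if h : ∃ x, Q x ≠ 0 then Projectivization.mk ℂ (Q h.choose) h.choose_spec
  -- Junk value, reached only when `Q = 0`.
  else Projectivization.mk ℂ (EuclideanSpace.single 0 1) (by simp)

theorem imagePoint_eq {Q : CSpace (n + 1) →L[ℂ] CSpace (n + 1)}
    (hQ : ∀ x y b, Q x b • Q y = Q y b • Q x) {x : CSpace (n + 1)} (hx : Q x ≠ 0) :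
    imagePoint Q = Projectivization.mk ℂ (Q x) hx := by
  have hex : ∃ x, Q x ≠ 0 := ⟨x, hx⟩
  rw [imagePoint, dif_pos hex, Projectivization.mk_eq_mk_iff']
  obtain ⟨b, hb⟩ : ∃ b, Q x b ≠ 0 := by
    by_contra! hzero
    exact hx (PiLp.ext hzero)
  refine ⟨Q hex.choose b / Q x b, ?_⟩
  rw [div_eq_inv_mul, mul_smul, ← hQ x hex.choose b, inv_smul_smul₀ hb]

theorem isHolomorphicMap_imagePoint {D : Set (CSpace m)} (hD : IsOpen D)
    {Q : CSpace m → CSpace (n + 1) →L[ℂ] CSpace (n + 1)} (hQ : DifferentiableOn ℂ Q D)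
    (hcol : ∀ z ∈ D, ∀ x y b, Q z x b • Q z y = Q z y b • Q z x)
    (hne : ∀ z ∈ D, ∃ x, Q z x ≠ 0) : IsHolomorphicMap D fun z => imagePoint (Q z) := by
  intro z hz
  obtain ⟨x, hx⟩ := hne z hz
  have hd : DifferentiableOn ℂ (fun w => Q w x) D := fun w hw =>
    (hQ w hw).clm_apply (differentiableWithinAt_const x)
  refine ⟨D ∩ (fun w => Q w x) ⁻¹' {0}ᶜ,
    hd.continuousOn.isOpen_inter_preimage hD isOpen_compl_singleton, ⟨hz, hx⟩,
    Set.inter_subset_left, fun w => Q w x, hd.mono Set.inter_subset_left, ?_⟩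
  exact fun w hw => ⟨hw.2, imagePoint_eq (hcol w hw.1) hw.2⟩

end Limits

/-! ### Choice of indices and the main theorem. -/

theorem exists_strictMono_apply_eq {n q : ℕ} (hq : n + 1 ≤ q) (j : Fin q) :
    ∃ (σ : Fin (n + 1) → Fin q) (i : Fin (n + 1)), StrictMono σ ∧ σ i = j := by
  obtain ⟨s, hjs, hs⟩ := Finset.exists_superset_card_eq (s := {j}) (n := n + 1) (by simp)
    (by simpa using hq)
  obtain ⟨i, hi⟩ : j ∈ Set.range (s.orderEmbOfFin hs) := by
    rw [Finset.range_orderEmbOfFin]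
    exact hjs (Finset.mem_singleton_self j)
  exact ⟨s.orderEmbOfFin hs, i, (s.orderEmbOfFin hs).strictMono, hi⟩

theorem mainTheorem4 {m n q : ℕ} (hn : 1 ≤ n) (hq : n + 1 ≤ q)
    (D : Set (CSpace m)) (hDopen : IsOpen D) (hDconn : IsConnected D)
    {𝒜 : Type*} (H : Fin q → 𝒜 → CSpace m → CProj n)
    (hHol : ∀ j α, IsHolomorphicMap D (H j α))
    (hSep : ∀ K ⊆ D, IsCompact K → ∃ δ : ℝ, 0 < δ ∧
      ∀ z ∈ K, ∀ α : 𝒜, ∀ j : Fin (n + 1) → Fin q, StrictMono j →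
        δ ≤ dFS (fun i => H (j i) α z)) :
    ∀ j : Fin q, IsNormalFamily D (Set.range (H j)) := by
  intro j f hf
  choose α hα using hf
  obtain ⟨σ, i, hσ, rfl⟩ := exists_strictMono_apply_eq hq j
  have hSep' : ∀ K ⊆ D, IsCompact K → ∃ δ : ℝ, 0 < δ ∧ δ < Real.pi ∧
      ∀ z ∈ K, ∀ k, δ ≤ dFS (fun l => H (σ l) (α k) z) := by
    intro K hKD hK
    obtain ⟨δ, hδ, h⟩ := hSep K hKD hK
    -- Capping at `1` keeps the angle below `π`, so that `sin δ > 0`.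
    exact ⟨min δ 1, by positivity, (min_le_right _ _).trans_lt (by linarith [Real.pi_gt_three]),
      fun z hz k => (min_le_left _ _).trans (h z hz (α k) σ hσ)⟩
  have hind : ∀ k, ∀ z ∈ D, LinearIndependent ℂ fun l => (H (σ l) (α k) z).rep := by
    intro k z hz
    obtain ⟨δ, hδ, hδ', h⟩ := hSep' {z} (by simpa using hz) isCompact_singleton
    exact linearIndependent_rep_of_le_dFS hδ hδ' (h z rfl k)
  let P : ℕ → CSpace m → CSpace (n + 1) →L[ℂ] CSpace (n + 1) := fun k z =>
    projOntoPoint i fun l => H (σ l) (α k) z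
  have hPrep : ∀ k, ∀ z ∈ D, P k z (f k z).rep = (f k z).rep := fun k z hz => by
    rw [← hα k]
    exact projOntoPoint_rep (hind k z hz) i
  obtain ⟨φ, hφ, Q, hQ, hlim⟩ := exists_subseq_tendstoUniformlyOn_of_norm_le hDopen (f := P)
    (fun k => differentiableOn_projOntoPoint (fun l => hHol (σ l) (α k)) (hind k) i)
    (fun K hKD hK => by
      obtain ⟨δ, hδ, hδ', h⟩ := hSep' K hKD hK
      exact ⟨_, fun k z hz => norm_projOntoPoint_le hδ hδ' (h z hz k) i⟩)
  have hlimz : ∀ z ∈ D, Tendsto (fun k => P (φ k) z) atTop (𝓝 (Q z)) := fun z hz =>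
    (hlim {z} (by simpa using hz) isCompact_singleton).tendsto_at rfl
  have hlimx : ∀ z ∈ D, ∀ x, Tendsto (fun k => P (φ k) z x) atTop (𝓝 (Q z x)) := fun z hz x =>
    ((ContinuousLinearMap.apply ℂ (CSpace (n + 1)) x).continuous.tendsto _).comp (hlimz z hz)
  have hlimb : ∀ z ∈ D, ∀ x b, Tendsto (fun k => P (φ k) z x b) atTop (𝓝 (Q z x b)) :=
    fun z hz x b => ((EuclideanSpace.proj (𝕜 := ℂ) b).continuous.tendsto _).comp (hlimx z hz x)
  have hcol : ∀ z ∈ D, ∀ x y b, Q z x b • Q z y = Q z y b • Q z x := fun z hz x y b =>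
    tendsto_nhds_unique ((hlimb z hz x b).smul (hlimx z hz y))
      (((hlimb z hz y b).smul (hlimx z hz x)).congr fun k =>
        (projOntoPoint_collinear (hind (φ k) z hz) i x y b).symm)
  -- Since `P (φ k) z` fixes the representative, the error is `(P (φ k) z - Q z)` applied to it; the
  -- bound is relative to its norm because `rep` is not normalised.
  have hclose : ∀ K ⊆ D, IsCompact K → ∀ η > 0, ∃ N, ∀ k ≥ N, ∀ z ∈ K,
      ‖(f (φ k) z).rep - Q z (f (φ k) z).rep‖ ≤ η * ‖(f (φ k) z).rep‖ := by
    intro K hKD hK η hη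
    obtain ⟨N, hN⟩ := eventually_atTop.1 (Metric.tendstoUniformlyOn_iff.1 (hlim K hKD hK) η hη)
    refine ⟨N, fun k hk z hz => ?_⟩
    have h1 := hN k hk z hz
    rw [dist_comm, dist_eq_norm] at h1
    have h2 := (P (φ k) z - Q z).le_of_opNorm_le h1.le (f (φ k) z).rep
    rwa [sub_apply, hPrep _ z (hKD hz)] at h2
  have hne_of_close : ∀ {v w : CSpace (n + 1)} {η : ℝ}, v ≠ 0 → η < 1 → ‖v - w‖ ≤ η * ‖v‖ →
      w ≠ 0 := by
    rintro v w η hv hη h rfl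
    rw [sub_zero] at h
    nlinarith [norm_pos_iff.2 hv]
  refine ⟨φ, hφ, fun z => imagePoint (Q z), isHolomorphicMap_imagePoint hDopen hQ hcol ?_, ?_⟩
  · intro z hz
    obtain ⟨N, hN⟩ := hclose {z} (by simpa using hz) isCompact_singleton (1 / 2) (by norm_num)
    exact ⟨_, hne_of_close (f (φ N) z).rep_nonzero (by norm_num) (hN N le_rfl z rfl)⟩
  · intro K hKD hK ε hε
    obtain ⟨η, hη, hη1, hηε⟩ := exists_pos_arccos_lt hε
    obtain ⟨N, hN⟩ := hclose K hKD hK η hη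
    refine ⟨N, fun k hk z hz => ?_⟩
    have hne := hne_of_close (f (φ k) z).rep_nonzero hη1 (hN k hk z hz)
    have := fsDist_mk_le_arccos (f (φ k) z).rep_nonzero hne hη.le (hN k hk z hz)
    rw [Projectivization.mk_rep, ← imagePoint_eq (hcol z (hKD hz)) hne] at this
    exact this.trans_lt hηε
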